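/- Let $p$ be a prime and let $\mathbb H=\overline{\mathbb F}_p((t^{\mathbb Q}))$ be the Hahn field, with its $t$-adic valuation $v$. Let $K$ be a subfield of $\mathbb H$ containing $\overline{\mathbb F}_p(t)$ which is perfect, Henselian with respect to $v$ (i.e. $v_{|K}$ has only one extension to the algebraic closure of $K$), and has no finite limits (i.e. for every $a\in K$ and every $\delta\in\mathbb R$ the set of $q<\delta$ in the support of $a$ is finite). Take $\alpha,\theta,\eta\in\mathbb H$ with $$\alpha^p-\alpha=t^{-1},\qquad \theta^p-\theta=\alpha,\qquad \eta^p-\eta=\alpha^2,$$ take $c\in\overline{\mathbb F}_p$ with $c^p-c=1$, and put $\gamma=\theta-c\alpha$. Consider the fields $L=K(\alpha)$, $L'=K(\gamma)$, $M_0=K(\theta)$ and $N=K(\theta,\eta)$, each with the restriction of $v$. For a finite Galois extension $\mathcal E=(E/K,v)$, with valuation ring $\mathcal O_E$ and maximal ideal $\mathcal M_E$, and for a subgroup $H$ of $\mathrm{Gal}(E/K)$, define the $\mathcal O_E$-submodule of $E$ $$I_H=\bigcup_{\sigma\in H}\left\{x\in E\ \middle|\ v(x)\ge v\left(\frac{\sigma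 b-b}{b}\right)\text{ for some }b\in E\setminus\{0\}\right\},$$ and let $\mathrm{Ram}(\mathcal E)=\{I_H\mid H\le\mathrm{Gal}(E/K),\ H\ne\{\mathrm{id}\}\}$. The ramification ideals of $\mathcal E$ are the elements of $\mathrm{Ram}(\mathcal E)$ contained in $\mathcal M_E$. Then: 1. $L/K$ and $L'/K$ are Galois of degree $p$, and each has exactly one ramification ideal, namely its maximal ideal; in fact $\mathrm{Ram}(L/K,v)=\{\mathcal M_L\}$ and $\mathrm{Ram}(L'/K,v)=\{\mathcal M_{L'}\}$. 2. $M_0/K$ is Galois of degree $p^2$ and has exactly one ramification ideal, namely its maximal ideal; in fact $\mathrm{Ram}(M_0/K,v)=\{\mathcal M_{M_0}\}$. 3. If $p>2$, then $N/K$ is Galois of degree $p^3$ and has exactly one ramification ideal, namely its maximal ideal; in fact $\mathrm{Ram}(N/K,v)=\{\mathcal M_N\}$. -/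

import Mathlib

namespace RamIdeals

section General

variable {F E Γ : Type*} [Field F] [Field E] [Algebra F E] [LinearOrderedAddCommGroupWithTop Γ]

/-- The valuation ring `{x | 0 ≤ v x}` of an additively written valuation `v` on a field. -/
def valRing (v : AddValuation E Γ) : ValuationSubring E where
  carrier := {x | 0 ≤ v x}
  mul_mem' {a b} ha hb := by
    simp only [Set.mem_ofPred_eq, AddValuation.map_mul] at *
    exact add_nonneg ha hb
  one_mem' := by simp
  add_mem' {a b} ha hb := by
    simp only [Set.mem_ofPred_eq] at *
    exact le_trans (le_min ha hb) (v.map_add a b)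
  zero_mem' := by simp
  neg_mem' {a} ha := by
    simpa only [Set.mem_ofPred_eq, AddValuation.map_neg] using ha
  mem_or_inv_mem' a := by
    show 0 ≤ v a ∨ 0 ≤ v a⁻¹
    by_cases h0 : a = 0
    · left; simp [h0]
    · by_contra! h
      have h1 : v a + v a⁻¹ = 0 := by
        rw [← AddValuation.map_mul, mul_inv_cancel₀ h0, AddValuation.map_one]
      have h2 : v a + v a⁻¹ ≤ v a := by
        calc v a + v a⁻¹ ≤ v a + 0 := add_le_add le_rfl h.2.le
          _ = v a := add_zero _
      rw [h1] at h2
      exact absurd h.1 (not_lt.mpr h2)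

/-- The maximal ideal `𝓜` of the valuation ring, as a submodule of the field. -/
def maxIdeal (v : AddValuation E Γ) : Submodule (valRing v) E :=
  Submodule.map (Algebra.linearMap (valRing v) E) (IsLocalRing.maximalIdeal (valRing v))

/-- The set `I_σ = {c ∈ E | v c ≥ v ((σ b - b) / b) for some b ∈ E, b ≠ 0}`. -/
def ramSet (v : AddValuation E Γ) (σ : E ≃ₐ[F] E) : Set E :=
  {c | ∃ b : E, b ≠ 0 ∧ v ((σ b - b) / b) ≤ v c}

/-- The fractional ideal `I_H`, whose underlying set is the union of the `I_σ` for `σ ∈ H`. -/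
def ramIdeal (v : AddValuation E Γ) (H : Subgroup (E ≃ₐ[F] E)) : Submodule (valRing v) E where
  carrier := ⋃ σ ∈ H, ramSet v σ
  add_mem' {x y} hx hy := by
    simp only [Set.mem_iUnion, ramSet, Set.mem_ofPred_eq, exists_prop] at *
    obtain ⟨σ, hσ, b, hb, hxb⟩ := hx
    obtain ⟨τ, hτ, d, hd, hyd⟩ := hy
    rcases le_total (v x) (v y) with h | h
    · exact ⟨σ, hσ, b, hb, hxb.trans ((le_min le_rfl h).trans (v.map_add x y))⟩
    · exact ⟨τ, hτ, d, hd, hyd.trans ((le_min h le_rfl).trans (v.map_add x y))⟩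
  zero_mem' := by
    simp only [Set.mem_iUnion, ramSet, Set.mem_ofPred_eq, exists_prop]
    exact ⟨1, H.one_mem, 1, one_ne_zero, by simp⟩
  smul_mem' r x hx := by
    simp only [Set.mem_iUnion, ramSet, Set.mem_ofPred_eq, exists_prop] at *
    obtain ⟨σ, hσ, b, hb, hxb⟩ := hx
    refine ⟨σ, hσ, b, hb, hxb.trans ?_⟩
    have hr : 0 ≤ v (r : E) := r.2
    have h : v (r • x) = v (r : E) + v x := v.map_mul (r : E) x
    rw [h]
    exact le_add_of_nonneg_left hr

variable (F) in
/-- `Ram(E/F, v) = {I_H | H a non-trivial subgroup of Gal(E/F)}`. -/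
def ramFamily (v : AddValuation E Γ) : Set (Submodule (valRing v) E) :=
  {I | ∃ H : Subgroup (E ≃ₐ[F] E), H ≠ ⊥ ∧ I = ramIdeal v H}

variable (F) in
/-- The ramification ideals of `(E/F, v)`: the members of `Ram(E/F, v)` contained in `𝓜`. -/
def ramificationIdeals (v : AddValuation E Γ) : Set (Submodule (valRing v) E) :=
  {I | I ∈ ramFamily F v ∧ I ≤ maxIdeal v}

/-- The valued field `(F, v)` is Henselian: `v` has only one extension to the algebraic closure
of `F`. Valuations up to equivalence are represented by their valuation rings. -/
def IsHenselianField (v : AddValuation F Γ) : Prop :=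
  ∀ A B : ValuationSubring (AlgebraicClosure F),
    A.comap (algebraMap F (AlgebraicClosure F)) = valRing v →
    B.comap (algebraMap F (AlgebraicClosure F)) = valRing v → A = B

end General

/-- The Hahn field `𝔽̄_p((t^ℚ))`. -/
abbrev Hahn (p : ℕ) [Fact p.Prime] : Type := HahnSeries ℚ (AlgebraicClosure (ZMod p))

variable {p : ℕ} [Fact p.Prime]

/-- The `t`-adic valuation on the Hahn field, restricted to a field `E` mapping to it. -/
noncomputable def tadic (E : Type*) [Field E] [Algebra E (Hahn p)] :
    AddValuation E (WithTop ℚ) :=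
  (HahnSeries.addVal ℚ (AlgebraicClosure (ZMod p))).comap (algebraMap E (Hahn p))

/-- `a` has no finite limits: the truncation of `a` at any real `δ` has finite support. -/
def NoFiniteLimits (a : Hahn p) : Prop :=
  ∀ δ : ℝ, {q : ℚ | q ∈ a.support ∧ (q : ℝ) < δ}.Finite

/-- `K` is a subfield of `𝔽̄_p((t^ℚ))` containing `𝔽̄_p(t)` which is perfect, Henselian (for the
`t`-adic valuation) and has no finite limits. -/
structure IsBaseField (K : Subfield (Hahn p)) : Prop where
  const_mem : ∀ c : AlgebraicClosure (ZMod p), (HahnSeries.C c : Hahn p) ∈ K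
  t_mem : (HahnSeries.single 1 1 : Hahn p) ∈ K
  perfect : PerfectField K
  henselian : IsHenselianField (tadic (p := p) K)
  noFiniteLimits : ∀ a ∈ K, NoFiniteLimits a

/-- `(M/K, v)` is a Galois extension of degree `d` with `Ram(M/K, v) = {𝓜}`; in particular it has
exactly one ramification ideal, the maximal ideal `𝓜`. -/
def OnlyMaxIdeal (K : Subfield (Hahn p)) (M : IntermediateField K (Hahn p)) (d : ℕ) : Prop :=
  IsGalois K M ∧ Module.finrank K M = d ∧
    ramFamily K (tadic (p := p) M) = {maxIdeal (tadic (p := p) M)} ∧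
    ramificationIdeals K (tadic (p := p) M) = {maxIdeal (tadic (p := p) M)}

end RamIdeals

/-! Every nontrivial `H` gives `I_H = 𝓜`, by two inclusions. Inclusion in `𝓜`: as `K` is Henselian,
every automorphism `σ` is an isometry. Comparing leading coefficients, `σ b` is `ζ b` plus terms of
higher value, with `ζ` a constant; `σ` fixes constants, so `σ ^ n` has leading ratio `ζ ^ n`. The
Galois group has order a power of `p`, so `ζ ^ p ^ n = 1`, hence `ζ = 1` in characteristic `p`, and
`(σ b - b) / b` has positive value (`val_lt_val_sub`). Equality: for `σ ≠ 1` some generator `x` is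
moved by a nonzero constant and can be approximated from a subfield fixed by `σ`: for each `ε > 0`
there is `a` there with `v (x - a) ≥ -ε`. Then `b = x - a` gives `v ((σ b - b) / b) ≤ ε`. The
approximations are partial sums of `a ^ (1/p) + a ^ (1/p²) + ⋯`, formed in a perfect field
(`exists_approx_of_pow_sub_self`). Both `α` and `θ` are approximated from `K`, and `η` from `K(θ)`.
Degrees: an Artin-Schreier root of `d t⁻¹`, `d ≠ 0`, has infinitely many negative exponents, so `α,
γ ∉ K`. If `θ ∈ K(α)`, Galois theory would put some `θ - c α` with `c ^ p - c = 1` in `K`. If `η ∈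
K(θ)`, the conjugates of `η` would contradict commutativity of the Galois group of `K(θ)` when `p >
2`. -/

namespace RamIdeals

/-! ### Conjugates of Artin-Schreier roots and normality -/

section ArtinSchreier

open IntermediateField Polynomial

variable {p : ℕ} [Fact p.Prime] {k K E Ω : Type*} [Field k] [IsAlgClosed k] [Field K] [Field E]
  [Field Ω] [Algebra K E] [Algebra K Ω]

/-- A solution of `y ^ p - y = a` with `a` in an algebraically closed subfield lies in that
subfield. -/
theorem exists_eq_map_of_pow_sub_self_eq (g : k →+* Ω) {a : k} {y : Ω} (hy : y ^ p - y = g a) :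
    ∃ b, y = g b ∧ b ^ p - b = a := by
  have hp : 1 < p := (Fact.out : p.Prime).one_lt
  set P : k[X] := X ^ p - X - C a with hP
  have hP0 : P ≠ 0 := by
    intro h
    have hd : P.coeff p = 1 := by
      simp [hP, coeff_X, hp.ne, coeff_C, (zero_lt_one.trans hp).ne']
    simp [h] at hd
  have hr : (P.map g).IsRoot y := by
    simp [hP, hy]
  obtain ⟨b, rfl⟩ := (IsAlgClosed.splits P).mem_range_of_isRoot hP0 hr
  exact ⟨b, rfl, g.injective (by simpa using hy)⟩

variable (f : k →+* K)

theorem charP_of_ringHom_algebra {k K Ω : Type*} [Field k] [Field K] [Field Ω] [Algebra K Ω]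
    (f : k →+* K) (p : ℕ) [CharP k p] : CharP Ω p :=
  charP_of_injective_ringHom ((algebraMap K Ω).comp f).injective p

/-- Two elements with conjugate Artin-Schreier polynomials differ by a constant. -/
theorem exists_eq_add_of_pow_sub_self [CharP k p] {a : k} {x y : Ω}
    (h : x ^ p - x = y ^ p - y + algebraMap K Ω (f a)) :
    ∃ b, x = y + algebraMap K Ω (f b) ∧ b ^ p - b = a := by
  have : CharP Ω p := charP_of_ringHom_algebra f p
  obtain ⟨b, hb, hb'⟩ := exists_eq_map_of_pow_sub_self_eq (p := p) ((algebraMap K Ω).comp f)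
    (a := a) (y := x - y) (by
      rw [sub_pow_char]
      simp only [RingHom.comp_apply]
      linear_combination h)
  exact ⟨b, by rw [← sub_eq_iff_eq_add']; exact hb, hb'⟩

/-- Conjugates of a first Artin-Schreier root. -/
theorem exists_conj_alpha [CharP k p] (φ ψ : E →ₐ[K] Ω) {α : E} {a : K}
    (hα : α ^ p - α = algebraMap K E a) :
    ∃ i : k, i ^ p = i ∧ φ α = ψ α + algebraMap K Ω (f i) := by
  have h1 := congrArg φ hα
  have h2 := congrArg ψ hα
  simp only [map_sub, map_pow, AlgHom.commutes] at h1 h2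
  obtain ⟨b, hb, hb'⟩ := exists_eq_add_of_pow_sub_self (p := p) f (a := 0) (x := φ α) (y := ψ α)
    (by rw [h1, h2]; simp)
  exact ⟨b, sub_eq_zero.mp hb', hb⟩

/-- Conjugates of a second Artin-Schreier root. -/
theorem exists_conj_theta [CharP k p] (φ ψ : E →ₐ[K] Ω) {α θ : E} (hθ : θ ^ p - θ = α) {i : k}
    (hi : φ α = ψ α + algebraMap K Ω (f i)) :
    ∃ w : k, w ^ p - w = i ∧ φ θ = ψ θ + algebraMap K Ω (f w) := by
  have h1 := congrArg φ hθ
  have h2 := congrArg ψ hθ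
  simp only [map_sub, map_pow] at h1 h2
  obtain ⟨b, hb, hb'⟩ := exists_eq_add_of_pow_sub_self (p := p) f (a := i) (x := φ θ) (y := ψ θ)
    (by rw [h1, h2, hi])
  exact ⟨b, hb', hb⟩

/-- Conjugates of a third Artin-Schreier root. -/
theorem exists_conj_eta [CharP k p] (φ ψ : E →ₐ[K] Ω) {α θ η : E} (hθ : θ ^ p - θ = α)
    (hη : η ^ p - η = α ^ 2) {i : k} (hip : i ^ p = i) (hi : φ α = ψ α + algebraMap K Ω (f i)) :
    ∃ w : k, φ η = ψ η + 2 * algebraMap K Ω (f i) * ψ θ + algebraMap K Ω (f w) := by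
  have : CharP Ω p := charP_of_ringHom_algebra f p
  have h1 := congrArg φ hη
  have h2 := congrArg ψ hη
  have h3 := congrArg ψ hθ
  simp only [map_sub, map_pow] at h1 h2 h3
  have hip' : (algebraMap K Ω (f i)) ^ p = algebraMap K Ω (f i) := by
    rw [← map_pow, ← map_pow, hip]
  have h2p : (2 : Ω) ^ p = 2 := by
    have := add_pow_char (1 : Ω) 1 (p := p)
    rw [one_pow] at this
    rw [← one_add_one_eq_two, this]
  -- Since `(α + i)² = α² + 2iα + i²` and `2i` lies in the prime field, `2iα` is the Artin-Schreier
  -- polynomial of `2iθ`; only the constant `i²` remains.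
  obtain ⟨b, hb, -⟩ := exists_eq_add_of_pow_sub_self (p := p) f (a := i ^ 2) (x := φ η)
    (y := ψ η + 2 * algebraMap K Ω (f i) * ψ θ) (by
      rw [add_pow_char, mul_pow, mul_pow, h2p, hip', h1, hi, map_pow, map_pow]
      linear_combination - h2 - 2 * algebraMap K Ω (f i) * h3)
  exact ⟨b, hb⟩

/-- An intermediate field of `K(S)/K` containing `S` is everything. -/
theorem intermediateField_eq_top_of_generators {S : Set E} (T : IntermediateField K (adjoin K S))
    (h : ∀ s (hs : s ∈ S), (⟨s, subset_adjoin K S hs⟩ : adjoin K S) ∈ T) : T = ⊤ := by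
  have h1 : adjoin K S ≤ T.map (adjoin K S).val :=
    adjoin_le_iff.mpr fun s hs => ⟨⟨s, subset_adjoin K S hs⟩, h s hs, rfl⟩
  refine eq_top_iff.mpr fun x _ => ?_
  obtain ⟨y, hy, hyx⟩ := h1 x.2
  rwa [← Subtype.val_injective (show y.val = x.val from hyx)]

/-- `K(S)/K` is normal if every embedding of `K(S)` into the algebraic closure of `K(S)` maps `S`
into `K(S)`. -/
theorem normal_adjoin_of_forall_algHom {S : Set E} (hS : ∀ s ∈ S, IsIntegral K s)
    (h : ∀ φ : adjoin K S →ₐ[K] AlgebraicClosure (adjoin K S), ∀ s (hs : s ∈ S),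
      φ ⟨s, subset_adjoin K S hs⟩ ∈
        (IsScalarTower.toAlgHom K (adjoin K S) (AlgebraicClosure (adjoin K S))).fieldRange) :
    Normal K (adjoin K S) := by
  have : Algebra.IsAlgebraic K (adjoin K S) := isAlgebraic_adjoin hS
  -- The algebraic closure of `K(S)` is also one of `K`, hence normal over `K`; normality of `K(S)`
  -- becomes stability of its image.
  have : Algebra.IsAlgebraic K (AlgebraicClosure (adjoin K S)) :=
    Algebra.IsAlgebraic.trans K (adjoin K S) _
  have : IsAlgClosure K (AlgebraicClosure (adjoin K S)) := ⟨inferInstance, inferInstance⟩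
  have : Normal K (AlgebraicClosure (adjoin K S)) := IsAlgClosure.normal K _
  set ι := IsScalarTower.toAlgHom K (adjoin K S) (AlgebraicClosure (adjoin K S))
  let e : adjoin K S ≃ₐ[K] ι.fieldRange := AlgEquiv.ofInjectiveField ι
  have hn : Normal K ι.fieldRange := by
    rw [normal_iff_forall_fieldRange_le]
    rintro σ _ ⟨y, rfl⟩
    have hT := intermediateField_eq_top_of_generators
      (ι.fieldRange.comap (σ.comp e.toAlgHom)) fun s hs => by
        change σ (e ⟨s, subset_adjoin K S hs⟩) ∈ ι.fieldRange
        exact h (σ.comp e.toAlgHom) s hs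
    have hy : e.symm y ∈ ι.fieldRange.comap (σ.comp e.toAlgHom) := hT ▸ mem_top
    have hy' : σ (e (e.symm y)) ∈ ι.fieldRange := hy
    rwa [e.apply_symm_apply] at hy'
  exact Normal.of_algEquiv e.symm

end ArtinSchreier

end RamIdeals

namespace RamIdeals

/-! ### Galois property and degrees of the towers -/

section Degrees

open IntermediateField Polynomial

variable {p : ℕ} [Fact p.Prime] {k K H : Type*} [Field k] [IsAlgClosed k] [Field K] [Field H]
  [Algebra K H] [CharP k p]

theorem isIntegral_of_pow_sub_self {R A : Type*} [CommRing R] [Nontrivial R] [CommRing A]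
    [Algebra R A] {x : A} (hx : IsIntegral R (x ^ p - x)) : IsIntegral R x := by
  have hp : 1 < p := (Fact.out : p.Prime).one_lt
  have hd : (X : R[X]).degree < (X ^ p : R[X]).degree := by
    rw [degree_X_pow, degree_X]
    exact_mod_cast hp
  refine IsIntegral.of_aeval_monic (p := X ^ p - X) ((monic_X_pow p).sub_of_left hd) ?_ ?_
  · rw [natDegree_sub_eq_left_of_natDegree_lt] <;> simp [hp, (zero_lt_one.trans hp).ne']
  · simpa using hx

/-- `K(α)/K` is Galois when `α ^ p - α ∈ K`. -/
theorem isGalois_adjoin_alpha [PerfectField K] (f : k →+* K) {α : H} {a : K}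
    (hα : α ^ p - α = algebraMap K H a) : IsGalois K (adjoin K {α}) := by
  have hint : ∀ s ∈ ({α} : Set H), IsIntegral K s := by
    rintro s rfl
    exact isIntegral_of_pow_sub_self (hα ▸ isIntegral_algebraMap)
  have : Algebra.IsAlgebraic K (adjoin K {α}) := isAlgebraic_adjoin hint
  have : Normal K (adjoin K {α}) := by
    refine normal_adjoin_of_forall_algHom hint fun φ s hs => ?_
    obtain rfl : s = α := hs
    obtain ⟨i, -, h⟩ := exists_conj_alpha (p := p) f φ (IsScalarTower.toAlgHom K _ _)
      (α := ⟨s, subset_adjoin K {s} rfl⟩) (a := a) (Subtype.ext hα)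
    rw [h]
    exact add_mem ⟨_, rfl⟩ (IntermediateField.algebraMap_mem _ _)
  exact { }

theorem isGalois_adjoin_theta [PerfectField K] (f : k →+* K) {α θ : H} {a : K}
    (hα : α ^ p - α = algebraMap K H a) (hθ : θ ^ p - θ = α) : IsGalois K (adjoin K {θ}) := by
  have hint : ∀ s ∈ ({θ} : Set H), IsIntegral K s := by
    rintro s rfl
    exact isIntegral_of_pow_sub_self (hθ ▸ isIntegral_of_pow_sub_self (hα ▸ isIntegral_algebraMap))
  have : Algebra.IsAlgebraic K (adjoin K {θ}) := isAlgebraic_adjoin hint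
  have : Normal K (adjoin K {θ}) := by
    refine normal_adjoin_of_forall_algHom hint fun φ s hs => ?_
    obtain rfl : s = θ := hs
    set θ' : adjoin K {s} := ⟨s, subset_adjoin K {s} rfl⟩ with hθ'
    obtain ⟨i, -, hi⟩ := exists_conj_alpha (p := p) f φ (IsScalarTower.toAlgHom K _ _)
      (α := θ' ^ p - θ') (a := a) (Subtype.ext (by simpa [hθ', hθ] using hα))
    obtain ⟨w, -, h⟩ := exists_conj_theta (p := p) f φ (IsScalarTower.toAlgHom K _ _) rfl hi
    rw [h]
    exact add_mem ⟨_, rfl⟩ (IntermediateField.algebraMap_mem _ _)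
  exact { }

/-- Conjugates of `η` differ from `η` by `2iθ` plus a constant, so they stay in the field once `θ`
is adjoined too. -/
theorem isGalois_adjoin_theta_eta [PerfectField K] (f : k →+* K) {α θ η : H} {a : K}
    (hα : α ^ p - α = algebraMap K H a) (hθ : θ ^ p - θ = α) (hη : η ^ p - η = α ^ 2) :
    IsGalois K (adjoin K {θ, η}) := by
  have hαi : IsIntegral K α := isIntegral_of_pow_sub_self (hα ▸ isIntegral_algebraMap)
  have hint : ∀ s ∈ ({θ, η} : Set H), IsIntegral K s := by
    rintro s (rfl | rfl)
    · exact isIntegral_of_pow_sub_self (hθ ▸ hαi)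
    · exact isIntegral_of_pow_sub_self (hη ▸ hαi.pow 2)
  have : Algebra.IsAlgebraic K (adjoin K {θ, η}) := isAlgebraic_adjoin hint
  have : Normal K (adjoin K {θ, η}) := by
    refine normal_adjoin_of_forall_algHom hint fun φ s hs => ?_
    set θ' : adjoin K {θ, η} := ⟨θ, subset_adjoin K _ (by simp)⟩ with hθ'
    set η' : adjoin K {θ, η} := ⟨η, subset_adjoin K _ (by simp)⟩ with hη'
    obtain ⟨i, hip, hi⟩ := exists_conj_alpha (p := p) f φ (IsScalarTower.toAlgHom K _ _)
      (α := θ' ^ p - θ') (a := a) (Subtype.ext (by simpa [hθ', hθ] using hα))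
    obtain rfl | rfl := hs
    · obtain ⟨w, -, h⟩ := exists_conj_theta (p := p) f φ (IsScalarTower.toAlgHom K _ _) rfl hi
      rw [h]
      exact add_mem ⟨_, rfl⟩ (IntermediateField.algebraMap_mem _ _)
    · obtain ⟨w, h⟩ := exists_conj_eta (p := p) f φ (IsScalarTower.toAlgHom K _ _) rfl
        (η := η') (Subtype.ext (by simpa [hθ', hη', hθ] using hη)) hip hi
      rw [h]
      exact add_mem (add_mem ⟨_, rfl⟩ (mul_mem (mul_mem (ofNat_mem _ _) (IntermediateField.algebraMap_mem _ _))
        ⟨_, rfl⟩)) (IntermediateField.algebraMap_mem _ _)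
  exact { }

/-- An automorphism of `K(S)` fixing `S` is trivial. -/
theorem algEquiv_eq_one_of_generators {S : Set H} (σ : adjoin K S ≃ₐ[K] adjoin K S)
    (h : ∀ s (hs : s ∈ S), σ ⟨s, subset_adjoin K S hs⟩ = ⟨s, subset_adjoin K S hs⟩) : σ = 1 := by
  have h1 : σ.toAlgHom = AlgHom.id K _ := adjoin_algHom_ext K h
  exact AlgEquiv.ext fun y => congrArg (fun g : _ →ₐ[K] _ => g y) h1

theorem exists_algEquiv_apply_ne {E : Type*} [Field E] [Algebra K E] [FiniteDimensional K E]
    [IsGalois K E] {x : E} (hx : x ∉ Set.range (algebraMap K E)) : ∃ σ : E ≃ₐ[K] E, σ x ≠ x := by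
  by_contra! h
  exact hx ((IsGalois.mem_range_algebraMap_iff_fixed x).mpr h)

/-- A nontrivial Artin-Schreier extension has degree `p`. -/
theorem finrank_adjoin_of_pow_sub_self [PerfectField K] (f : k →+* K) {x : H} {a : K}
    (hx : x ^ p - x = algebraMap K H a) (hxK : x ∉ Set.range (algebraMap K H)) :
    Module.finrank K (adjoin K {x}) = p := by
  have hp : p.Prime := Fact.out
  have hint : IsIntegral K x := isIntegral_of_pow_sub_self (hx ▸ isIntegral_algebraMap)
  have := adjoin.finiteDimensional hint
  have := isGalois_adjoin_alpha f hx
  have : CharP K p := charP_of_injective_ringHom f.injective p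
  apply le_antisymm
  · rw [adjoin.finrank hint]
    have hdeg : (X ^ p - X - C a : K[X]).natDegree = p := by
      rw [natDegree_sub_C, natDegree_sub_eq_left_of_natDegree_lt] <;> simp [hp.one_lt]
    have hne : (X ^ p - X - C a : K[X]) ≠ 0 := by
      intro h
      rw [h, natDegree_zero] at hdeg
      exact hp.ne_zero hdeg.symm
    exact (natDegree_le_of_dvd (minpoly.dvd K x (by simp [hx])) hne).trans hdeg.le
  · rw [← IsGalois.card_aut_eq_finrank]
    set x' : adjoin K {x} := ⟨x, subset_adjoin K {x} rfl⟩ with hx'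
    obtain ⟨σ, hσ⟩ := exists_algEquiv_apply_ne (K := K) (x := x') (by
      rintro ⟨y, hy⟩
      exact hxK ⟨y, congrArg Subtype.val hy⟩)
    obtain ⟨i, -, hi⟩ := exists_conj_alpha (p := p) f σ.toAlgHom (AlgHom.id K _) (α := x') (a := a)
      (Subtype.ext hx)
    -- An automorphism moving `x` is a translation, hence has order exactly `p`; this bounds the
    -- degree below.
    have hpow : ∀ n : ℕ, (σ ^ n) x' = x' + algebraMap K _ (n * f i) := by
      intro n
      induction n with
      | zero => simp
      | succ n ih =>
        rw [pow_succ', AlgEquiv.mul_apply, ih, map_add, AlgEquiv.commutes]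
        change σ x' = x' + _ at hi
        rw [hi, add_assoc, ← map_add]
        congr 2
        push_cast
        ring
    have hσp : σ ^ p = 1 := by
      refine algEquiv_eq_one_of_generators _ fun y hy => ?_
      obtain rfl : y = x := hy
      change (σ ^ p) x' = x'
      rw [hpow]
      simp
    have hord : orderOf σ = p := orderOf_eq_prime hσp (by rintro rfl; exact hσ rfl)
    rw [← hord]
    exact orderOf_le_card

/-- Adjoining a new Artin-Schreier root multiplies the degree by `p`. -/
theorem finrank_adjoin_union_of_pow_sub_self [PerfectField K] (f : k →+* K) {S : Set H}
    (hS : ∀ s ∈ S, IsIntegral K s) {x : H}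
    (hx : x ^ p - x ∈ adjoin K S) (hxK : x ∉ adjoin K S) :
    Module.finrank K (adjoin K (S ∪ {x})) = Module.finrank K (adjoin K S) * p := by
  have : Algebra.IsAlgebraic K (adjoin K S) := isAlgebraic_adjoin hS
  have : PerfectField (adjoin K S) := Algebra.IsAlgebraic.perfectField K
  have h1 := finrank_adjoin_of_pow_sub_self (p := p) (K := adjoin K S)
    ((algebraMap K (adjoin K S)).comp f) (x := x) (a := ⟨_, hx⟩) rfl
    (by rintro ⟨y, rfl⟩; exact hxK y.2)
  rw [← adjoin_adjoin_left, ← h1]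
  exact (Module.finrank_mul_finrank K (adjoin K S) (adjoin (adjoin K S) {x})).symm

/-- If `θ ∈ K(α)`, then some `θ - c α` with `c ^ p - c = 1` lies in `K`. -/
theorem theta_notMem_adjoin_alpha [PerfectField K] (f : k →+* K) {α θ : H} {a : K}
    (hα : α ^ p - α = algebraMap K H a) (hθ : θ ^ p - θ = α)
    (hαK : α ∉ Set.range (algebraMap K H))
    (hγ : ∀ c : k, c ^ p - c = 1 → θ - algebraMap K H (f c) * α ∉ Set.range (algebraMap K H)) :
    θ ∉ adjoin K {α} := by
  intro hmem
  have hint : IsIntegral K α := isIntegral_of_pow_sub_self (hα ▸ isIntegral_algebraMap)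
  have := adjoin.finiteDimensional hint
  have := isGalois_adjoin_alpha f hα
  set α' : adjoin K {α} := ⟨α, subset_adjoin K {α} rfl⟩ with hα'
  set θ' : adjoin K {α} := ⟨θ, hmem⟩
  obtain ⟨σ, hσ⟩ := exists_algEquiv_apply_ne (K := K) (x := α') (by
    rintro ⟨y, hy⟩
    exact hαK ⟨y, congrArg Subtype.val hy⟩)
  obtain ⟨i, hip, hi⟩ := exists_conj_alpha (p := p) f σ.toAlgHom (AlgHom.id K _) (α := α') (a := a)
    (Subtype.ext hα)
  obtain ⟨w, hw, hθw⟩ := exists_conj_theta (p := p) f σ.toAlgHom (AlgHom.id K _) (θ := θ')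
    (Subtype.ext hθ) hi
  change σ α' = α' + _ at hi
  change σ θ' = θ' + _ at hθw
  have hi0 : i ≠ 0 := by
    rintro rfl
    exact hσ (by simpa using hi)
  -- `σ` translates `α` by `i` and `θ` by `w`, so `c = w / i` cancels both shifts. From `i ^ p = i`
  -- and `w ^ p - w = i` comes `c ^ p - c = 1`.
  have hfix : σ (θ' - algebraMap K _ (f (w / i)) * α') = θ' - algebraMap K _ (f (w / i)) * α' := by
    rw [map_sub, map_mul, AlgEquiv.commutes, hi, hθw, mul_add, ← map_mul, ← map_mul,
      div_mul_cancel₀ _ hi0]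
    ring
  have hcard : Nat.card (adjoin K {α} ≃ₐ[K] adjoin K {α}) = p := by
    rw [IsGalois.card_aut_eq_finrank, finrank_adjoin_of_pow_sub_self f hα hαK]
  obtain ⟨y, hy⟩ := (IsGalois.mem_range_algebraMap_iff_fixed (F := K)
    (θ' - algebraMap K _ (f (w / i)) * α')).mpr fun τ => by
      obtain ⟨n, rfl⟩ := Subgroup.mem_zpowers_iff.mp
        (mem_zpowers_of_prime_card hcard (g := σ) (g' := τ) (by rintro rfl; exact hσ rfl))
      have hs : σ ∈ MulAction.stabilizer (adjoin K {α} ≃ₐ[K] adjoin K {α})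
        (θ' - algebraMap K _ (f (w / i)) * α') := hfix
      exact zpow_mem hs n
  refine hγ (w / i) ?_ ⟨y, congrArg Subtype.val hy⟩
  rw [div_pow, hip, ← sub_div, hw, div_self hi0]

theorem finrank_adjoin_theta [PerfectField K] (f : k →+* K) {α θ : H} {a : K}
    (hα : α ^ p - α = algebraMap K H a) (hθ : θ ^ p - θ = α)
    (hαK : α ∉ Set.range (algebraMap K H))
    (hγ : ∀ c : k, c ^ p - c = 1 → θ - algebraMap K H (f c) * α ∉ Set.range (algebraMap K H)) :
    Module.finrank K (adjoin K {θ}) = p ^ 2 := by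
  have hint : IsIntegral K α := isIntegral_of_pow_sub_self (hα ▸ isIntegral_algebraMap)
  have h1 : adjoin K {θ} = adjoin K ({α} ∪ {θ}) := by
    apply le_antisymm
    · exact adjoin.mono _ _ _ (by simp)
    · have hθm : θ ∈ adjoin K {θ} := subset_adjoin K {θ} rfl
      refine adjoin_le_iff.mpr ?_
      rintro s (rfl | rfl)
      · exact hθ ▸ sub_mem (pow_mem hθm p) hθm
      · exact hθm
  rw [h1, finrank_adjoin_union_of_pow_sub_self f (by rintro s rfl; exact hint)
    (hθ ▸ subset_adjoin K {α} rfl) (theta_notMem_adjoin_alpha f hα hθ hαK hγ),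
    finrank_adjoin_of_pow_sub_self f hα hαK, sq]

/-- The Galois group of `K(θ)/K` is abelian, while the conjugates of `η` do not permit this. -/
theorem eta_notMem_adjoin_theta [PerfectField K] (f : k →+* K) (hp2 : 2 < p) {α θ η : H} {a : K}
    (hα : α ^ p - α = algebraMap K H a) (hθ : θ ^ p - θ = α) (hη : η ^ p - η = α ^ 2)
    (hαK : α ∉ Set.range (algebraMap K H)) (hθα : θ ∉ adjoin K {α}) :
    η ∉ adjoin K {θ} := by
  intro hmem
  have hint : IsIntegral K θ :=
    isIntegral_of_pow_sub_self (hθ ▸ isIntegral_of_pow_sub_self (hα ▸ isIntegral_algebraMap))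
  have := adjoin.finiteDimensional hint
  have := isGalois_adjoin_theta f hα hθ
  set θ' : adjoin K {θ} := ⟨θ, subset_adjoin K {θ} rfl⟩ with hθ'
  set α' : adjoin K {θ} := θ' ^ p - θ' with hα'
  set η' : adjoin K {θ} := ⟨η, hmem⟩
  have hα'val : (α' : H) = α := by simp [hα', hθ', hθ]
  have hα1 : α' ^ p - α' = algebraMap K _ a := Subtype.ext (by simpa [hα'val] using hα)
  have hη1 : η' ^ p - η' = α' ^ 2 := Subtype.ext (by simpa [hα'val] using hη)
  obtain ⟨σ, hσ⟩ := exists_algEquiv_apply_ne (K := K) (x := α') (by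
    rintro ⟨y, hy⟩
    exact hαK ⟨y, by rw [← hα'val, ← hy]; rfl⟩)
  -- Such a `τ` exists by the Galois correspondence, because `θ ∉ K(α)`.
  obtain ⟨τ, hτα, hτ⟩ : ∃ τ : adjoin K {θ} ≃ₐ[K] adjoin K {θ}, τ α' = α' ∧ τ θ' ≠ θ' := by
    by_contra! h
    have h1 : θ' ∈ fixedField (fixingSubgroup (adjoin K {α'})) := by
      rintro ⟨τ, hτ⟩
      exact h τ (hτ ⟨α', subset_adjoin K {α'} rfl⟩)
    rw [IsGalois.fixedField_fixingSubgroup] at h1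
    have h2 : (adjoin K {θ}).val θ' ∈ (adjoin K {α'}).map (adjoin K {θ}).val := ⟨θ', h1, rfl⟩
    rw [adjoin_map, Set.image_singleton] at h2
    exact hθα (hα'val ▸ h2)
  obtain ⟨i, hip, hi⟩ := exists_conj_alpha (p := p) f σ.toAlgHom (AlgHom.id K _) hα1
  obtain ⟨w, -, hw⟩ := exists_conj_theta (p := p) f σ.toAlgHom (AlgHom.id K _) rfl hi
  obtain ⟨u, hu⟩ := exists_conj_eta (p := p) f σ.toAlgHom (AlgHom.id K _) rfl hη1 hip hi
  have hj : τ.toAlgHom α' = AlgHom.id K _ α' + algebraMap K _ (f 0) := by simpa using hτα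
  obtain ⟨z, -, hz⟩ := exists_conj_theta (p := p) f τ.toAlgHom (AlgHom.id K _) rfl hj
  obtain ⟨v, hv⟩ := exists_conj_eta (p := p) f τ.toAlgHom (AlgHom.id K _) rfl hη1
    (zero_pow (Fact.out : p.Prime).ne_zero) hj
  change σ α' = α' + _ at hi
  change σ θ' = θ' + _ at hw
  change σ η' = η' + _ * θ' + _ at hu
  change τ θ' = θ' + _ at hz
  change τ η' = η' + _ * θ' + _ at hv
  -- Both translate `θ` by constants, so they commute. On `η`, however, the two compositions differ
  -- by `2iz`, where `i` and `z` are the nonzero shifts of `α` under `σ` and of `θ` under `τ`.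
  have hcomm : (σ.toAlgHom.comp τ.toAlgHom) = (τ.toAlgHom.comp σ.toAlgHom) := by
    refine adjoin_algHom_ext K fun y hy => ?_
    obtain rfl : y = θ := hy
    change σ (τ θ') = τ (σ θ')
    simp only [hw, hz, map_add, AlgEquiv.commutes]
    ring
  have h1 : σ (τ η') = τ (σ η') := congrArg (fun g : _ →ₐ[K] _ => g η') hcomm
  simp only [hu, hv, hz, hw, map_add, map_mul, map_zero, AlgEquiv.commutes, map_ofNat] at h1
  have h2 : algebraMap K (adjoin K {θ}) (f (2 * i * z)) = 0 := by
    simp only [map_mul, map_ofNat]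
    linear_combination - h1
  have h3 : 2 * i * z = 0 := f.injective ((algebraMap K (adjoin K {θ})).injective (by simpa using h2))
  have h20 : (2 : k) ≠ 0 := by
    intro h
    have : p ∣ 2 := (CharP.cast_eq_zero_iff k p 2).mp (by exact_mod_cast h)
    exact absurd (Nat.le_of_dvd two_pos this) (not_le.mpr hp2)
  rcases mul_eq_zero.mp h3 with h4 | rfl
  · rcases mul_eq_zero.mp h4 with h5 | rfl
    · exact h20 h5
    · exact hσ (by simpa using hi)
  · exact hτ (by simpa using hz)

theorem finrank_adjoin_theta_eta [PerfectField K] (f : k →+* K) (hp2 : 2 < p) {α θ η : H} {a : K}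
    (hα : α ^ p - α = algebraMap K H a) (hθ : θ ^ p - θ = α) (hη : η ^ p - η = α ^ 2)
    (hαK : α ∉ Set.range (algebraMap K H))
    (hγ : ∀ c : k, c ^ p - c = 1 → θ - algebraMap K H (f c) * α ∉ Set.range (algebraMap K H)) :
    Module.finrank K (adjoin K {θ, η}) = p ^ 3 := by
  have hint : IsIntegral K θ :=
    isIntegral_of_pow_sub_self (hθ ▸ isIntegral_of_pow_sub_self (hα ▸ isIntegral_algebraMap))
  have hθm : θ ∈ adjoin K {θ} := subset_adjoin K {θ} rfl
  have h1 : ({θ, η} : Set H) = {θ} ∪ {η} := rfl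
  rw [h1, finrank_adjoin_union_of_pow_sub_self f (by rintro s rfl; exact hint)
    (by rw [hη, ← hθ]; exact pow_mem (sub_mem (pow_mem hθm p) hθm) 2)
    (eta_notMem_adjoin_theta f hp2 hα hθ hη hαK (theta_notMem_adjoin_alpha f hα hθ hαK hγ)),
    finrank_adjoin_theta f hα hθ hαK hγ]
  ring

end Degrees

end RamIdeals

namespace RamIdeals

/-! ### Henselian isometries and a criterion for ramification ideals -/

section Valued

variable {F E Γ : Type*} [Field F] [Field E] [Algebra F E] [LinearOrderedAddCommGroupWithTop Γ]

theorem mem_valRing (v : AddValuation E Γ) {x : E} : x ∈ valRing v ↔ 0 ≤ v x := Iff.rfl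

theorem mem_maxIdeal (v : AddValuation E Γ) {x : E} : x ∈ maxIdeal v ↔ 0 < v x := by
  constructor
  · rintro ⟨y, hy, rfl⟩
    change 0 < v (y : E)
    refine lt_of_le_of_ne y.2 fun h => ?_
    have hy0 : (y : E) ≠ 0 := by
      intro h0
      rw [h0, AddValuation.map_zero] at h
      exact LinearOrderedAddCommGroupWithTop.zero_ne_top h
    have hinv : (0 : Γ) ≤ v (y : E)⁻¹ := by rw [AddValuation.map_inv, ← h, neg_zero]
    refine (IsLocalRing.mem_maximalIdeal y).mp hy (IsUnit.of_mul_eq_one ⟨(y : E)⁻¹, hinv⟩ ?_)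
    exact Subtype.ext (mul_inv_cancel₀ hy0)
  · intro hx
    refine ⟨⟨x, hx.le⟩, (IsLocalRing.mem_maximalIdeal _).mpr fun hu => ?_, rfl⟩
    obtain ⟨y, hy⟩ := hu.exists_right_inv
    have h1 := congrArg (fun z : valRing v => v (z : E)) hy
    change v (x * y) = v 1 at h1
    rw [AddValuation.map_mul, AddValuation.map_one] at h1
    have h2 : (0 : Γ) ≤ v (y : E) := y.2
    exact absurd h1 (add_pos_of_pos_of_nonneg hx h2).ne'

/-- Every valuation ring extends along a field embedding. -/
theorem exists_valuationSubring_comap_eq {Ω : Type*} [Field Ω] (ι : E →+* Ω)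
    (O : ValuationSubring E) : ∃ A : ValuationSubring Ω, A.comap ι = O := by
  obtain ⟨A, hA, hloc⟩ := (LocalSubring.map ι O.toLocalSubring).exists_le_valuationSubring
  have hle : ∀ x ∈ O, ι x ∈ A := fun x hx => hA ⟨x, hx, rfl⟩
  refine ⟨A, SetLike.ext fun x => ⟨fun hx => ?_, hle x⟩⟩
  rcases O.mem_or_inv_mem x with h | h
  · exact h
  by_cases hx0 : x = 0
  · rw [hx0]; exact O.zero_mem
  have hx' : ι x ∈ A := hx
  -- Here `x⁻¹ ∈ O` becomes a unit of `A`. Since `A` dominates the image of `O`, it is already a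
  -- unit there, which returns `x` to `O`.
  have hu : IsUnit (Subring.inclusion hA ⟨ι x⁻¹, x⁻¹, h, rfl⟩) := by
    refine IsUnit.of_mul_eq_one (⟨ι x, hx'⟩ : A.toLocalSubring.toSubring) (Subtype.ext ?_)
    change ι x⁻¹ * ι x = 1
    rw [← map_mul, inv_mul_cancel₀ hx0, map_one]
  obtain ⟨⟨_, z, hz, rfl⟩, hy⟩ := (hloc.map_nonunit _ hu).exists_right_inv
  have h1 : ι (x⁻¹ * z) = ι 1 := by
    rw [map_mul, map_one]
    exact congrArg Subtype.val hy
  have h2 := ι.injective h1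
  rw [inv_mul_eq_iff_eq_mul₀ hx0, mul_one] at h2
  exact h2 ▸ hz

/-- Over a Henselian field, automorphisms preserve the valuation ring. -/
theorem IsHenselianField.map_nonneg_iff [Algebra.IsAlgebraic F E] {w : AddValuation F Γ}
    (hw : IsHenselianField w) {v : AddValuation E Γ} (hv : ∀ x, v (algebraMap F E x) = w x)
    (σ : E ≃ₐ[F] E) (x : E) : 0 ≤ v (σ x) ↔ 0 ≤ v x := by
  let ι : E →ₐ[F] AlgebraicClosure F := IsAlgClosed.lift
  -- Extending `v` along `ι` and along `ι ∘ σ` gives two valuation rings over that of `w`; they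
  -- coincide, so membership of `σ x` and of `x` is tested by the same ring.
  let κ : E →ₐ[F] AlgebraicClosure F := ι.comp σ.toAlgHom
  obtain ⟨A, hA⟩ := exists_valuationSubring_comap_eq ι.toRingHom (valRing v)
  obtain ⟨B, hB⟩ := exists_valuationSubring_comap_eq κ.toRingHom (valRing v)
  have hbase : ∀ (φ : E →ₐ[F] AlgebraicClosure F) (C : ValuationSubring (AlgebraicClosure F)),
      C.comap φ.toRingHom = valRing v →
        C.comap (algebraMap F (AlgebraicClosure F)) = valRing w := by
    intro φ C hC
    refine SetLike.ext fun y => ?_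
    have h1 : algebraMap F E y ∈ C.comap φ.toRingHom ↔ algebraMap F E y ∈ valRing v := by rw [hC]
    rw [mem_valRing, hv] at h1
    change φ (algebraMap F E y) ∈ C ↔ _ at h1
    rw [φ.commutes] at h1
    exact h1
  have hAB := hw A B (hbase ι A hA) (hbase κ B hB)
  subst hAB
  have h1 : σ x ∈ A.comap ι.toRingHom ↔ x ∈ A.comap κ.toRingHom := Iff.rfl
  rw [hA, hB] at h1
  exact h1

theorem exists_val_eq {v : AddValuation E (WithTop ℚ)} {x : E} (hx : x ≠ 0) :
    ∃ q : ℚ, v x = q := by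
  obtain ⟨q, hq⟩ := WithTop.ne_top_iff_exists.mp ((AddValuation.ne_top_iff v).mpr hx)
  exact ⟨q, hq.symm⟩

theorem exists_val_eq_intCast {w : AddValuation F (WithTop ℚ)} {t : F} (ht : w t = (1 : ℚ))
    (m : ℤ) : ∃ s : F, w s = ((m : ℚ) : WithTop ℚ) := by
  have hpow : ∀ n : ℕ, w (t ^ n) = ((n : ℚ) : WithTop ℚ) := by
    intro n
    rw [AddValuation.map_pow, ht, ← WithTop.coe_nsmul]
    simp
  obtain ⟨n, rfl | rfl⟩ := m.eq_nat_or_neg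
  · exact ⟨t ^ n, by simpa using hpow n⟩
  · refine ⟨(t ^ n)⁻¹, ?_⟩
    rw [AddValuation.map_inv, hpow, ← WithTop.LinearOrderedAddCommGroup.coe_neg]
    simp

/-- Over a Henselian field with value group in `ℚ`, automorphisms are isometries. -/
theorem IsHenselianField.map_algEquiv [Algebra.IsAlgebraic F E] {w : AddValuation F (WithTop ℚ)}
    (hw : IsHenselianField w) {v : AddValuation E (WithTop ℚ)}
    (hv : ∀ x, v (algebraMap F E x) = w x) {t : F} (ht : w t = (1 : ℚ))
    (σ : E ≃ₐ[F] E) (x : E) : v (σ x) = v x := by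
  have key : ∀ (σ : E ≃ₐ[F] E) (x : E), v x ≤ v (σ x) := by
    intro σ x
    by_cases hx : x = 0
    · simp [hx]
    obtain ⟨q, hq⟩ := exists_val_eq (v := v) hx
    obtain ⟨r, hr⟩ := exists_val_eq (v := v) (σ.injective.ne hx |>.trans_eq (map_zero σ))
    -- With `q = v x`, the element `x ^ q.den * s` has value `0`; preservation of nonnegativity then
    -- yields `v x ≤ v (σ x)`.
    obtain ⟨s, hs⟩ := exists_val_eq_intCast ht (-q.num)
    have hqd : (q.den : ℚ) * q = q.num := by rw [mul_comm]; exact Rat.mul_den_eq_num q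
    have h1 : ∀ (y : E) (u : ℚ), v y = u →
        v (y ^ q.den * algebraMap F E s) = ((q.den * u - q.num : ℚ) : WithTop ℚ) := by
      intro y u hu
      rw [AddValuation.map_mul, AddValuation.map_pow, hv, hs, hu, ← WithTop.coe_nsmul,
        ← WithTop.coe_add]
      simp [sub_eq_add_neg]
    have h2 := (hw.map_nonneg_iff hv σ (x ^ q.den * algebraMap F E s)).mpr (by
      rw [h1 x q hq, hqd, sub_self]; exact le_rfl)
    rw [map_mul, map_pow, AlgEquiv.commutes, h1 _ r hr, ← hqd, ← mul_sub] at h2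
    have h3 : 0 ≤ (q.den : ℚ) * (r - q) := by exact_mod_cast h2
    have h4 : 0 ≤ r - q := nonneg_of_mul_nonneg_right h3 (by exact_mod_cast q.den_pos)
    rw [hq, hr]
    exact_mod_cast sub_nonneg.mp h4
  refine le_antisymm ?_ (key σ x)
  simpa using key σ.symm (σ x)

theorem mem_ramIdeal {v : AddValuation E Γ} {G : Subgroup (E ≃ₐ[F] E)} {x : E} :
    x ∈ ramIdeal v G ↔ ∃ σ ∈ G, ∃ b : E, b ≠ 0 ∧ v ((σ b - b) / b) ≤ v x := by
  change x ∈ ⋃ σ ∈ G, ramSet v σ ↔ _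
  simp [ramSet]

/-- If all quotients `(σ b - b) / b` have positive value and every nontrivial automorphism moves
elements of value arbitrarily close to `0` by elements of nonpositive value, then every nontrivial
subgroup has the maximal ideal as its ramification ideal. -/
theorem ramIdeal_eq_maxIdeal {v : AddValuation E (WithTop ℚ)}
    (hlt : ∀ (σ : E ≃ₐ[F] E) (b : E), b ≠ 0 → 0 < v ((σ b - b) / b))
    (h : ∀ σ : E ≃ₐ[F] E, σ ≠ 1 → ∀ ε : ℚ, 0 < ε → ∃ b : E, σ b ≠ b ∧
      v (σ b - b) ≤ 0 ∧ ((-ε : ℚ) : WithTop ℚ) ≤ v b)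
    {G : Subgroup (E ≃ₐ[F] E)} (hG : G ≠ ⊥) : ramIdeal v G = maxIdeal v := by
  refine SetLike.ext fun x => ?_
  rw [mem_maxIdeal, mem_ramIdeal]
  constructor
  · rintro ⟨σ, -, b, hb, hx⟩
    exact (hlt σ b hb).trans_le hx
  · intro hx
    obtain ⟨⟨σ, hσG⟩, hσ⟩ := Subgroup.ne_bot_iff_exists_ne_one.mp hG
    obtain ⟨ε, hε, hεx⟩ : ∃ ε : ℚ, 0 < ε ∧ ((ε : ℚ) : WithTop ℚ) ≤ v x := by
      by_cases hx0 : x = 0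
      · exact ⟨1, one_pos, by simp [hx0]⟩
      · obtain ⟨q, hq⟩ := exists_val_eq (v := v) hx0
        rw [hq] at hx
        exact ⟨q, by exact_mod_cast hx, hq.ge⟩
    obtain ⟨b, hb, hb1, hb2⟩ := h σ (fun h0 => hσ (Subtype.ext h0)) ε hε
    have hb0 : b ≠ 0 := by
      rintro rfl
      simp at hb
    refine ⟨σ, hσG, b, hb0, le_trans ?_ hεx⟩
    obtain ⟨u, hu⟩ := exists_val_eq (v := v) hb0
    obtain ⟨w, hw⟩ := exists_val_eq (v := v) (sub_ne_zero.mpr hb)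
    obtain ⟨r, hr⟩ := exists_val_eq (v := v) (div_ne_zero (sub_ne_zero.mpr hb) hb0)
    have h5 : v ((σ b - b) / b * b) = w := by rw [div_mul_cancel₀ _ hb0, hw]
    rw [AddValuation.map_mul, hr, hu, ← WithTop.coe_add, WithTop.coe_inj] at h5
    rw [hw] at hb1
    rw [hu, WithTop.coe_le_coe] at hb2
    have hb1' : w ≤ 0 := by exact_mod_cast hb1
    rw [hr, WithTop.coe_le_coe]
    linarith

end Valued

end RamIdeals

namespace RamIdeals

variable {p : ℕ} [Fact p.Prime]

/-! ### Leading terms and approximation in the Hahn field -/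

section HahnField

open IntermediateField

instance charP_hahn : CharP (Hahn p) p :=
  charP_of_injective_ringHom (f := (HahnSeries.C : AlgebraicClosure (ZMod p) →+* Hahn p))
    HahnSeries.C_injective p

/-- The `t`-adic valuation of the Hahn field. -/
noncomputable abbrev hahnVal (p : ℕ) [Fact p.Prime] : AddValuation (Hahn p) (WithTop ℚ) :=
  HahnSeries.addVal ℚ (AlgebraicClosure (ZMod p))

/-- Elements of equal value agree up to a constant and terms of higher value. -/
theorem exists_lt_val_sub_C_mul {x y : Hahn p} (hy : y ≠ 0) (h : hahnVal p x = hahnVal p y) :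
    ∃ ζ, hahnVal p y < hahnVal p (x - HahnSeries.C ζ * y) := by
  obtain ⟨q, hq⟩ := exists_val_eq (v := hahnVal p) hy
  rw [hq] at h ⊢
  rw [HahnSeries.addVal_apply] at h hq
  have hy0 := HahnSeries.coeff_orderTop_ne hq
  refine ⟨x.coeff q / y.coeff q, ?_⟩
  rw [HahnSeries.addVal_apply]
  by_contra! hlt
  set z := x - HahnSeries.C (x.coeff q / y.coeff q) * y with hz
  have hcoeff : ∀ g, z.coeff g = x.coeff g - x.coeff q / y.coeff q * y.coeff g := by
    intro g
    rw [hz, HahnSeries.coeff_sub, HahnSeries.C_mul_eq_smul, HahnSeries.coeff_smul, smul_eq_mul]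
  have hz0 : z ≠ 0 := by
    intro h0
    rw [h0, HahnSeries.orderTop_zero] at hlt
    exact absurd hlt (by simp)
  obtain ⟨g, hg⟩ := WithTop.ne_top_iff_exists.mp (HahnSeries.orderTop_ne_top.mpr hz0)
  have hg0 := HahnSeries.coeff_orderTop_ne hg.symm
  rw [← hg, WithTop.coe_le_coe] at hlt
  apply hg0
  rw [hcoeff]
  rcases hlt.lt_or_eq with hlt | rfl
  · have h1 := WithTop.coe_lt_coe.mpr hlt
    rw [HahnSeries.coeff_eq_zero_of_lt_orderTop (x := x) (h1.trans_eq h.symm),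
      HahnSeries.coeff_eq_zero_of_lt_orderTop (x := y) (h1.trans_eq hq.symm)]
    simp
  · field_simp
    simp

theorem val_C_mul {ζ : AlgebraicClosure (ZMod p)} (hζ : ζ ≠ 0) (x : Hahn p) :
    hahnVal p (HahnSeries.C ζ * x) = hahnVal p x := by
  rw [AddValuation.map_mul, HahnSeries.addVal_apply, HahnSeries.C_apply,
    HahnSeries.orderTop_single hζ]
  exact zero_add _

theorem val_le_val_C_mul (ζ : AlgebraicClosure (ZMod p)) (x : Hahn p) :
    hahnVal p x ≤ hahnVal p (HahnSeries.C ζ * x) := by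
  by_cases hζ : ζ = 0
  · simp [hζ]
  · exact (val_C_mul hζ x).ge

/-- An automorphism of `p`-power order that is an isometry and fixes the constants moves each
nonzero element by an element of higher value. -/
theorem val_lt_val_sub {E : Type*} [Field E] [Algebra E (Hahn p)] (σ : E ≃+* E)
    (c : AlgebraicClosure (ZMod p) →+* E)
    (hc : ∀ ζ, algebraMap E (Hahn p) (c ζ) = HahnSeries.C ζ) (hσc : ∀ ζ, σ (c ζ) = c ζ)
    (hv : ∀ x, tadic (p := p) E (σ x) = tadic (p := p) E x) {m : ℕ} (hm : σ ^ p ^ m = 1)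
    {b : E} (hb : b ≠ 0) : tadic (p := p) E b < tadic (p := p) E (σ b - b) := by
  have hval : ∀ x : E, tadic (p := p) E x = hahnVal p (algebraMap E (Hahn p) x) := fun _ => rfl
  have hc' : ∀ ζ x, tadic (p := p) E x ≤ tadic (p := p) E (c ζ * x) := by
    intro ζ x
    rw [hval, hval, map_mul, hc]
    exact val_le_val_C_mul ζ _
  obtain ⟨ζ, hζ⟩ := exists_lt_val_sub_C_mul (x := algebraMap E (Hahn p) (σ b))
    (y := algebraMap E (Hahn p) b) (by simpa using hb) (hv b)
  rw [← hc, ← map_mul, ← map_sub, ← hval, ← hval] at hζ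
  -- The ratio of leading coefficients is multiplicative along powers of `σ`, because `σ` fixes
  -- constants and preserves values.
  have hpow : ∀ n : ℕ, tadic (p := p) E b < tadic (p := p) E ((σ ^ n) b - c (ζ ^ n) * b) := by
    intro n
    induction n with
    | zero =>
      simp only [pow_zero, map_one, one_mul, RingAut.one_apply, sub_self, AddValuation.map_zero]
      exact lt_top_iff_ne_top.mpr ((AddValuation.ne_top_iff _).mpr hb)
    | succ n ih =>
      have h1 : (σ ^ (n + 1)) b - c (ζ ^ (n + 1)) * b =
          σ ((σ ^ n) b - c (ζ ^ n) * b) + c (ζ ^ n) * (σ b - c ζ * b) := by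
        rw [pow_succ' σ, RingAut.mul_apply, map_sub, map_mul, hσc, pow_succ ζ, map_mul]
        ring
      rw [h1]
      refine AddValuation.map_lt_add _ ?_ (hζ.trans_le (hc' _ _))
      rwa [hv]
  have h1 := hpow (p ^ m)
  rw [hm, RingAut.one_apply] at h1
  have h2 : ζ ^ p ^ m = 1 := by
    by_contra h
    have h3 : algebraMap E (Hahn p) (b - c (ζ ^ p ^ m) * b) =
        HahnSeries.C (1 - ζ ^ p ^ m) * algebraMap E (Hahn p) b := by
      rw [map_sub, map_mul, hc, map_sub, map_one]
      ring
    rw [hval, hval, h3, val_C_mul (sub_ne_zero.mpr (Ne.symm h))] at h1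
    exact lt_irrefl _ h1
  have h4 : ζ = 1 := by
    have h5 : (ζ - 1) ^ p ^ m = 0 := by rw [sub_pow_char_pow, h2, one_pow, sub_self]
    exact sub_eq_zero.mp (pow_eq_zero_iff (pow_ne_zero _ (Fact.out : p.Prime).ne_zero) |>.mp h5)
  simpa [h4] using hζ

/-- The constants of a base field. -/
noncomputable def IsBaseField.constHom {K : Subfield (Hahn p)} (hK : IsBaseField K) :
    AlgebraicClosure (ZMod p) →+* K :=
  HahnSeries.C.codRestrict K hK.const_mem

/-- If every nontrivial automorphism moves elements of value arbitrarily close to `0` by elements of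
nonpositive value, then the maximal ideal is the only member of the ramification family. -/
theorem onlyMaxIdeal_of_exists {K : Subfield (Hahn p)} (hK : IsBaseField K)
    (M : IntermediateField K (Hahn p)) [IsGalois K M] {n : ℕ} (hn : n ≠ 0)
    (hd : Module.finrank K M = p ^ n)
    (h : ∀ σ : M ≃ₐ[K] M, σ ≠ 1 → ∀ ε : ℚ, 0 < ε → ∃ b : M, σ b ≠ b ∧
      hahnVal p (σ b - b : M) ≤ 0 ∧ ((-ε : ℚ) : WithTop ℚ) ≤ hahnVal p b) :
    OnlyMaxIdeal K M (p ^ n) := by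
  have hp : p.Prime := Fact.out
  have : FiniteDimensional K M := Module.finite_of_finrank_pos (hd ▸ pow_pos hp.pos n)
  have hcard : Nat.card (M ≃ₐ[K] M) = p ^ n := by rw [IsGalois.card_aut_eq_finrank, hd]
  have hiso : ∀ (σ : M ≃ₐ[K] M) (x : M), tadic (p := p) M (σ x) = tadic (p := p) M x :=
    hK.henselian.map_algEquiv (v := tadic (p := p) M) (fun _ => rfl) (t := ⟨_, hK.t_mem⟩)
      (HahnSeries.addVal_apply.trans (HahnSeries.orderTop_single one_ne_zero))
  have hlt : ∀ (σ : M ≃ₐ[K] M) (b : M), b ≠ 0 →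
      0 < tadic (p := p) M ((σ b - b) / b) := by
    intro σ b hb
    have h1 := val_lt_val_sub (σ : M ≃+* M) ((algebraMap K M).comp hK.constHom) (fun _ => rfl)
      (fun ζ => σ.commutes _) (hiso σ) (m := n) (by
        have h2 : σ ^ p ^ n = 1 := by rw [← hcard]; exact pow_card_eq_one'
        ext x
        have h3 : ∀ k : ℕ, ((σ : M ≃+* M) ^ k) x = (σ ^ k) x := by
          intro k
          induction k with
          | zero => rfl
          | succ k ih => rw [pow_succ', pow_succ', RingAut.mul_apply, ih]; rfl
        rw [h3, h2]
        rfl) hb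
    change tadic (p := p) M b < tadic (p := p) M (σ b - b) at h1
    have h4 : σ b - b = (σ b - b) / b * b := (div_mul_cancel₀ _ hb).symm
    rw [h4, AddValuation.map_mul] at h1
    by_contra hle
    exact absurd h1 (not_lt.mpr (add_le_of_nonpos_left (not_lt.mp hle)))
  have hram : ∀ G : Subgroup (M ≃ₐ[K] M), G ≠ ⊥ →
      ramIdeal (tadic (p := p) M) G = maxIdeal (tadic (p := p) M) :=
    fun G hG => ramIdeal_eq_maxIdeal hlt h hG
  -- A nontrivial subgroup must exist for the family to be nonempty; this is where `n ≠ 0` enters.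
  have hnt : (⊤ : Subgroup (M ≃ₐ[K] M)) ≠ ⊥ := by
    intro h0
    have h1 : Nat.card (⊤ : Subgroup (M ≃ₐ[K] M)) = 1 := by rw [h0]; exact Subgroup.card_bot
    rw [Subgroup.card_top, hcard] at h1
    exact hp.one_lt.ne' ((Nat.pow_eq_one.mp h1).resolve_right hn)
  have hfam : ramFamily K (tadic (p := p) M) = {maxIdeal (tadic (p := p) M)} := by
    ext I
    constructor
    · rintro ⟨G, hG, rfl⟩
      exact hram G hG
    · rintro rfl
      exact ⟨⊤, hnt, (hram ⊤ hnt).symm⟩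
  refine ⟨inferInstance, hd, hfam, ?_⟩
  ext I
  rw [ramificationIdeals, hfam]
  constructor
  · exact fun hI => hI.1
  · rintro rfl
    exact ⟨rfl, le_rfl⟩

/-- For `u < 0` the term `y ^ p` has value `p u < u` and dominates. -/
theorem val_pow_sub_self_of_neg {y : Hahn p} {u : ℚ} (hu : hahnVal p y = u) (hneg : u < 0) :
    hahnVal p (y ^ p - y) = ((p * u : ℚ) : WithTop ℚ) := by
  have hp : (1 : ℚ) < p := by exact_mod_cast (Fact.out : p.Prime).one_lt
  have h1 : hahnVal p (y ^ p) = ((p * u : ℚ) : WithTop ℚ) := by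
    rw [AddValuation.map_pow, hu, ← WithTop.coe_nsmul, nsmul_eq_mul]
  rw [← h1]
  rw [AddValuation.map_sub_swap]
  apply AddValuation.map_sub_eq_of_lt_right
  rw [h1, hu, WithTop.coe_lt_coe]
  nlinarith

theorem val_pow_sub_self_nonneg {y : Hahn p} (hy : 0 ≤ hahnVal p y) :
    0 ≤ hahnVal p (y ^ p - y) := by
  refine AddValuation.map_le_sub _ ?_ hy
  rw [AddValuation.map_pow]
  exact nsmul_nonneg hy p

/-- An element is at least as close to `0` as its Artin-Schreier polynomial. -/
theorem neg_le_val_of_pow_sub_self {y : Hahn p} {ε : ℚ} (hε : 0 < ε)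
    (h : ((-ε : ℚ) : WithTop ℚ) ≤ hahnVal p (y ^ p - y)) :
    ((-ε : ℚ) : WithTop ℚ) ≤ hahnVal p y := by
  have hp : (1 : ℚ) < p := by exact_mod_cast (Fact.out : p.Prime).one_lt
  by_cases hy : y = 0
  · simp [hy]
  obtain ⟨u, hu⟩ := exists_val_eq (v := hahnVal p) hy
  rw [hu, WithTop.coe_le_coe]
  by_contra! hlt
  rw [val_pow_sub_self_of_neg hu (by linarith), WithTop.coe_le_coe] at h
  nlinarith

/-- A root of nonnegative value would make `q` nonnegative, so `y ^ p` is the dominant term. -/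
theorem val_eq_div_of_pow_sub_self {y : Hahn p} {q : ℚ} (hq : q < 0)
    (h : hahnVal p (y ^ p - y) = q) : hahnVal p y = ((q / p : ℚ) : WithTop ℚ) := by
  have hp : (0 : ℚ) < p := by exact_mod_cast (Fact.out : p.Prime).pos
  have hneg : ¬ 0 ≤ hahnVal p y := by
    intro h0
    have h1 := val_pow_sub_self_nonneg h0
    rw [h] at h1
    have h2 : 0 ≤ q := by exact_mod_cast h1
    linarith
  have hy : y ≠ 0 := by
    rintro rfl
    simp at hneg
  obtain ⟨u, hu⟩ := exists_val_eq (v := hahnVal p) hy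
  rw [hu] at hneg ⊢
  have hu0 : u < 0 := by
    by_contra! h0
    exact hneg (by exact_mod_cast h0)
  rw [val_pow_sub_self_of_neg hu hu0, WithTop.coe_inj] at h
  rw [WithTop.coe_inj, ← h]
  field_simp

/-- If the Artin-Schreier polynomial of `x` can be approximated from a perfect subfield up to terms
of value close to `0`, then so can `x`. -/
theorem exists_approx_of_pow_sub_self {F : Subfield (Hahn p)} (hF : ∀ a ∈ F, ∃ b ∈ F, b ^ p = a)
    {x : Hahn p}
    (hx : ∀ ε : ℚ, 0 < ε → ∃ a ∈ F, ((-ε : ℚ) : WithTop ℚ) ≤ hahnVal p (x ^ p - x - a))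
    {ε : ℚ} (hε : 0 < ε) : ∃ b ∈ F, ((-ε : ℚ) : WithTop ℚ) ≤ hahnVal p (x - b) := by
  have hp : 1 < p := (Fact.out : p.Prime).one_lt
  obtain ⟨a, ha, hxa⟩ := hx ε hε
  -- Telescoping: `s` is the sum of the `p ^ j`-th roots of `a` for `1 ≤ j ≤ n`, and `r` is the last
  -- of these roots (`a` itself if `n = 0`).
  have key : ∀ n : ℕ, ∃ s ∈ F, ∃ r ∈ F, s ^ p - s = a - r ∧ r ^ p ^ n = a := by
    intro n
    induction n with
    | zero => exact ⟨0, F.zero_mem, a, ha, by simp [(zero_lt_one.trans hp).ne'], by simp⟩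
    | succ n ih =>
      obtain ⟨s, hs, r, hr, h1, h2⟩ := ih
      obtain ⟨r', hr', h3⟩ := hF r hr
      refine ⟨s + r', F.add_mem hs hr', r', hr', ?_, ?_⟩
      · rw [add_pow_char]
        linear_combination h1 + h3
      · rw [pow_succ', pow_mul, h3, h2]
  obtain ⟨n, hn⟩ : ∃ n : ℕ, ∀ r : Hahn p, r ^ p ^ n = a → ((-ε : ℚ) : WithTop ℚ) ≤ hahnVal p r := by
    by_cases ha0 : a = 0
    · refine ⟨0, fun r hr => ?_⟩
      rw [pow_zero, pow_one] at hr
      simp [hr, ha0]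
    obtain ⟨q, hq⟩ := exists_val_eq (v := hahnVal p) ha0
    -- The root `r` has value `q / p ^ n`, so `p ^ n > |q| / ε` brings it within `ε` of `0`.
    obtain ⟨n, hn⟩ := pow_unbounded_of_one_lt (|q| / ε) (show (1 : ℚ) < p by exact_mod_cast hp)
    refine ⟨n, fun r hr => ?_⟩
    have hr0 : r ≠ 0 := by
      rintro rfl
      rw [zero_pow (pow_ne_zero _ (zero_lt_one.trans hp).ne')] at hr
      exact ha0 hr.symm
    obtain ⟨u, hu⟩ := exists_val_eq (v := hahnVal p) hr0
    rw [← hr, AddValuation.map_pow, hu, ← WithTop.coe_nsmul, nsmul_eq_mul, WithTop.coe_inj] at hq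
    push_cast at hq
    rw [div_lt_iff₀ hε] at hn
    rw [hu, WithTop.coe_le_coe]
    by_contra! hlt
    have h1 : -q ≤ |q| := neg_le_abs q
    have h2 : (0 : ℚ) < (p : ℚ) ^ n := by positivity
    nlinarith
  obtain ⟨s, hs, r, -, h1, h2⟩ := key n
  refine ⟨s, hs, neg_le_val_of_pow_sub_self hε ?_⟩
  have h3 : (x - s) ^ p - (x - s) = (x ^ p - x - a) + r := by
    rw [sub_pow_char]
    linear_combination -h1
  rw [h3]
  exact AddValuation.map_le_add _ hxa (hn r h2)

/-- Artin-Schreier roots of `d t⁻¹` with `d ≠ 0` have finite limits. -/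
theorem not_noFiniteLimits_of_pow_sub_self {x : Hahn p} {d : AlgebraicClosure (ZMod p)}
    (hd : d ≠ 0) (hx : x ^ p - x = HahnSeries.single (-1) d) : ¬ NoFiniteLimits x := by
  have hp : 1 < p := (Fact.out : p.Prime).one_lt
  have hp' : (1 : ℚ) < p := by exact_mod_cast hp
  have hanti : StrictMono fun n : ℕ => (-(1 / (p : ℚ) ^ n)) := by
    intro m n hmn
    have : 1 / (p : ℚ) ^ n < 1 / (p : ℚ) ^ m :=
      one_div_lt_one_div_of_lt (by positivity) (pow_lt_pow_right₀ hp' hmn)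
    exact neg_lt_neg this
  -- Here `s` collects terms at exponents `-1/p, …, -1/p ^ n`. The remainder `x - s` then has
  -- leading exponent `-1/p ^ (n + 1)`, where `s` has no term, so this exponent lies in the support
  -- of `x`.
  have key : ∀ n : ℕ, ∃ (s : Hahn p) (e : AlgebraicClosure (ZMod p)), e ≠ 0 ∧
      (x - s) ^ p - (x - s) = HahnSeries.single (-(1 / (p : ℚ) ^ n)) e ∧
      ∀ m, n < m → s.coeff (-(1 / (p : ℚ) ^ m)) = 0 := by
    intro n
    induction n with
    | zero => exact ⟨0, d, hd, by simpa using hx, by simp⟩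
    | succ n ih =>
      obtain ⟨s, e, he, h1, h2⟩ := ih
      obtain ⟨e', he'⟩ := IsAlgClosed.exists_pow_nat_eq e (zero_lt_one.trans hp)
      refine ⟨s + HahnSeries.single (-(1 / (p : ℚ) ^ (n + 1))) e', e', ?_, ?_, fun m hm => ?_⟩
      · rintro rfl
        exact he (by rw [← he', zero_pow (zero_lt_one.trans hp).ne'])
      · have h3 : (HahnSeries.single (-(1 / (p : ℚ) ^ (n + 1))) e') ^ p =
            HahnSeries.single (-(1 / (p : ℚ) ^ n)) e := by
          rw [HahnSeries.single_pow, he', nsmul_eq_mul]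
          congr 2
          rw [pow_succ]
          field_simp
        rw [← sub_sub, sub_pow_char, h3]
        linear_combination h1
      · rw [HahnSeries.coeff_add, h2 m (by lia), HahnSeries.coeff_single_of_ne, add_zero]
        exact (hanti hm).ne'
  have hsupp : ∀ n : ℕ, -(1 / (p : ℚ) ^ (n + 1)) ∈ x.support := by
    intro n
    obtain ⟨s, e, he, h1, h2⟩ := key n
    have h3 := val_eq_div_of_pow_sub_self (y := x - s) (q := -(1 / (p : ℚ) ^ n))
      (neg_neg_of_pos (by positivity))
      (by rw [h1, HahnSeries.addVal_apply, HahnSeries.orderTop_single he])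
    have h4 : -(1 / (p : ℚ) ^ n) / p = -(1 / (p : ℚ) ^ (n + 1)) := by
      rw [pow_succ]
      field_simp
    rw [h4, HahnSeries.addVal_apply] at h3
    have h5 := HahnSeries.coeff_orderTop_ne h3
    rw [HahnSeries.coeff_sub, h2 (n + 1) (by lia), sub_zero] at h5
    exact h5
  -- These distinct exponents are all negative, so the bound `δ = 0` already contradicts finiteness.
  intro hfin
  have hmem : ∀ n : ℕ, -(1 / (p : ℚ) ^ (n + 1)) ∈ {q : ℚ | q ∈ x.support ∧ (q : ℝ) < (0 : ℝ)} := by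
    intro n
    have : -(1 / (p : ℚ) ^ (n + 1)) < 0 := neg_neg_of_pos (by positivity)
    exact ⟨hsupp n, by exact_mod_cast this⟩
  exact Set.infinite_of_injective_forall_mem
    (fun m n hmn => by simpa using hanti.injective (a₁ := m + 1) (a₂ := n + 1) hmn) hmem (hfin 0)

end HahnField

end RamIdeals

namespace RamIdeals

variable {p : ℕ} [Fact p.Prime]

/-! ### The ramification ideals of the individual extensions -/

section Extensions

open IntermediateField

variable {K : Subfield (Hahn p)}

/-- Algebraic extensions of perfect fields are perfect; this supplies the roots for the
approximation, over `K` and over `K(θ)`. -/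
theorem exists_mem_pow_eq [PerfectField K] (F : IntermediateField K (Hahn p))
    [Algebra.IsAlgebraic K F] : ∀ a ∈ F.toSubfield, ∃ b ∈ F.toSubfield, b ^ p = a := by
  intro a ha
  have : PerfectField F := Algebra.IsAlgebraic.perfectField K
  have : CharP F p := (RingHom.charP_iff (algebraMap F (Hahn p))
    (algebraMap F (Hahn p)).injective p).mpr inferInstance
  obtain ⟨b, hb⟩ := surjective_frobenius F p ⟨a, ha⟩
  exact ⟨b, b.2, congrArg Subtype.val hb⟩

theorem IsBaseField.single_mem (hK : IsBaseField K) (d : AlgebraicClosure (ZMod p)) :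
    (HahnSeries.single (-1) d : Hahn p) ∈ K := by
  have h1 : (HahnSeries.single (-1) d : Hahn p) =
      HahnSeries.C d * (HahnSeries.single 1 1 : Hahn p)⁻¹ := by
    rw [eq_mul_inv_iff_mul_eq₀ (by simp), HahnSeries.single_mul_single]
    simp [HahnSeries.C_apply]
  rw [h1]
  exact K.mul_mem (hK.const_mem d) (K.inv_mem hK.t_mem)

theorem IsBaseField.notMem_range_of_pow_sub_self (hK : IsBaseField K) {x : Hahn p}
    {d : AlgebraicClosure (ZMod p)} (hd : d ≠ 0) (hx : x ^ p - x = HahnSeries.single (-1) d) :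
    x ∉ Set.range (algebraMap K (Hahn p)) := by
  rintro ⟨y, rfl⟩
  exact not_noFiniteLimits_of_pow_sub_self hd hx (hK.noFiniteLimits _ y.2)

/-- An automorphism that moves `x` by a nonzero constant and fixes a field from which `x` can be
approximated moves elements of value close to `0` by constants. -/
theorem exists_move_of_approx (hK : IsBaseField K) {M F : IntermediateField K (Hahn p)}
    (hFM : F ≤ M) (σ : M ≃ₐ[K] M) (hσF : ∀ b (hb : b ∈ F), σ ⟨b, hFM hb⟩ = ⟨b, hFM hb⟩) {x : M}
    (hσx : σ x ≠ x) {ζ : AlgebraicClosure (ZMod p)}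
    (hζ : σ x = x + algebraMap K M (hK.constHom ζ)) {ε : ℚ}
    (hx : ∃ b ∈ F.toSubfield, ((-ε : ℚ) : WithTop ℚ) ≤ hahnVal p (x - b)) :
    ∃ b : M, σ b ≠ b ∧ hahnVal p (σ b - b : M) ≤ 0 ∧ ((-ε : ℚ) : WithTop ℚ) ≤ hahnVal p b := by
  obtain ⟨b, hb, hxb⟩ := hx
  have hζ0 : ζ ≠ 0 := by
    rintro rfl
    exact hσx (by simpa using hζ)
  have hmove : σ (x - ⟨b, hFM hb⟩) - (x - ⟨b, hFM hb⟩) = algebraMap K M (hK.constHom ζ) := by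
    rw [map_sub, hσF b hb, hζ]
    ring
  refine ⟨x - ⟨b, hFM hb⟩, ?_, ?_, hxb⟩
  · rw [← sub_ne_zero, hmove]
    simpa using hζ0
  · rw [hmove]
    exact (HahnSeries.addVal_apply.trans (HahnSeries.orderTop_single hζ0)).le

/-- The first Artin-Schreier step. -/
theorem onlyMaxIdeal_adjoin_alpha (hK : IsBaseField K) {x : Hahn p}
    {d : AlgebraicClosure (ZMod p)} (hd : d ≠ 0) (hx : x ^ p - x = HahnSeries.single (-1) d) :
    OnlyMaxIdeal K (adjoin K {x}) p := by
  have := hK.perfect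
  have hxa : x ^ p - x = algebraMap K (Hahn p) ⟨_, hK.single_mem d⟩ := hx
  have := isGalois_adjoin_alpha hK.constHom hxa
  have hdeg := finrank_adjoin_of_pow_sub_self hK.constHom hxa
    (hK.notMem_range_of_pow_sub_self hd hx)
  have h1 := onlyMaxIdeal_of_exists hK (adjoin K {x}) one_ne_zero (by rw [hdeg, pow_one])
    fun σ hσ ε hε => ?_
  · rwa [pow_one] at h1
  set x' : adjoin K {x} := ⟨x, subset_adjoin K {x} rfl⟩
  have hσx : σ x' ≠ x' := by
    intro h0
    refine hσ (algEquiv_eq_one_of_generators σ fun s hs => ?_)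
    obtain rfl : s = x := hs
    exact h0
  obtain ⟨ζ, -, hζ⟩ := exists_conj_alpha (p := p) hK.constHom σ.toAlgHom (AlgHom.id K _)
    (α := x') (Subtype.ext hxa)
  refine exists_move_of_approx hK (F := ⊥) bot_le σ ?_ hσx hζ
    (exists_approx_of_pow_sub_self (exists_mem_pow_eq ⊥) (fun ε _ => ?_) hε)
  · rintro _ ⟨y, rfl⟩
    exact σ.commutes y
  · exact ⟨_, algebraMap_mem ⊥ ⟨_, hK.single_mem d⟩, by rw [← hxa, sub_self]; simp⟩

/-- `θ` can be approximated from the base field. -/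
theorem exists_approx_theta (hK : IsBaseField K) {α θ : Hahn p}
    (hα : α ^ p - α = HahnSeries.single (-1) 1) (hθ : θ ^ p - θ = α) {ε : ℚ} (hε : 0 < ε) :
    ∃ b ∈ (⊥ : IntermediateField K (Hahn p)).toSubfield,
      ((-ε : ℚ) : WithTop ℚ) ≤ hahnVal p (θ - b) := by
  have := hK.perfect
  -- Approximating `θ` only requires approximating `θ ^ p - θ = α`, so the same lemma is applied
  -- twice.
  refine exists_approx_of_pow_sub_self (exists_mem_pow_eq ⊥) (fun δ hδ => ?_) hε
  rw [hθ]
  refine exists_approx_of_pow_sub_self (exists_mem_pow_eq ⊥) (fun δ _ => ?_) hδ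
  refine ⟨_, algebraMap_mem ⊥ ⟨_, hK.single_mem 1⟩, ?_⟩
  change _ ≤ hahnVal p (α ^ p - α - HahnSeries.single (-1) 1)
  rw [hα, sub_self]
  simp

/-- The identity `(cα) ^ p - cα = c ^ p (α ^ p - α) + (c ^ p - c) α` has second term `α`, cancelling
`θ ^ p - θ`. Thus `γ` is again a root over a multiple of `t⁻¹`, which serves both `K(γ)` and the
degree of `K(θ)`. -/
theorem gamma_pow_sub_self {α θ : Hahn p} (hα : α ^ p - α = HahnSeries.single (-1) 1)
    (hθ : θ ^ p - θ = α) {c : AlgebraicClosure (ZMod p)} (hc : c ^ p - c = 1) :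
    (θ - HahnSeries.C c * α) ^ p - (θ - HahnSeries.C c * α) =
      HahnSeries.single (-1) (-(c ^ p)) := by
  have h1 : (HahnSeries.single (-1) (-(c ^ p)) : Hahn p) =
      - HahnSeries.C c ^ p * HahnSeries.single (-1) 1 := by
    rw [← map_pow, ← map_neg, HahnSeries.C_apply, HahnSeries.single_mul_single]
    simp
  have h2 : (HahnSeries.C c : Hahn p) ^ p - HahnSeries.C c = 1 := by
    rw [← map_pow, ← map_sub, hc, map_one]
  rw [h1, sub_pow_char, mul_pow, ← hα]
  linear_combination hθ - α * h2

theorem neg_pow_ne_zero {c : AlgebraicClosure (ZMod p)} (hc : c ^ p - c = 1) : -(c ^ p) ≠ 0 := by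
  have hp : p ≠ 0 := (Fact.out : p.Prime).ne_zero
  intro h
  rw [neg_eq_zero, pow_eq_zero_iff hp] at h
  rw [h, zero_pow hp, sub_zero] at hc
  exact zero_ne_one hc

/-- The second Artin-Schreier step. -/
theorem onlyMaxIdeal_adjoin_theta (hK : IsBaseField K) {α θ : Hahn p}
    (hα : α ^ p - α = HahnSeries.single (-1) 1) (hθ : θ ^ p - θ = α) :
    OnlyMaxIdeal K (adjoin K {θ}) (p ^ 2) := by
  have := hK.perfect
  have hαa : α ^ p - α = algebraMap K (Hahn p) ⟨_, hK.single_mem 1⟩ := hα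
  have := isGalois_adjoin_theta hK.constHom hαa hθ
  have hdeg := finrank_adjoin_theta hK.constHom hαa hθ
    (hK.notMem_range_of_pow_sub_self one_ne_zero hα) fun c hc =>
      hK.notMem_range_of_pow_sub_self (neg_pow_ne_zero hc) (gamma_pow_sub_self hα hθ hc)
  refine onlyMaxIdeal_of_exists hK (adjoin K {θ}) two_ne_zero hdeg fun σ hσ ε hε => ?_
  set θ' : adjoin K {θ} := ⟨θ, subset_adjoin K {θ} rfl⟩ with hθ'
  have hσθ : σ θ' ≠ θ' := by
    intro h0
    refine hσ (algEquiv_eq_one_of_generators σ fun s hs => ?_)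
    obtain rfl : s = θ := hs
    exact h0
  obtain ⟨i, -, hi⟩ := exists_conj_alpha (p := p) hK.constHom σ.toAlgHom (AlgHom.id K _)
    (α := θ' ^ p - θ') (a := ⟨_, hK.single_mem 1⟩) (Subtype.ext (by simpa [hθ', hθ] using hαa))
  obtain ⟨ζ, -, hζ⟩ := exists_conj_theta (p := p) hK.constHom σ.toAlgHom (AlgHom.id K _) rfl hi
  refine exists_move_of_approx hK (F := ⊥) bot_le σ ?_ hσθ hζ (exists_approx_theta hK hα hθ hε)
  rintro _ ⟨y, rfl⟩
  exact σ.commutes y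

/-- Automorphisms of `K(θ, η)` over `K(θ)` move elements of value close to `0` by constants. -/
theorem exists_move_of_fixes_theta (hK : IsBaseField K) {α θ η : Hahn p}
    (hα : α ^ p - α = HahnSeries.single (-1) 1) (hθ : θ ^ p - θ = α) (hη : η ^ p - η = α ^ 2)
    {σ : adjoin K {θ, η} ≃ₐ[K] adjoin K {θ, η}} (hσ : σ ≠ 1)
    (hσθ : σ ⟨θ, subset_adjoin K _ (by simp)⟩ = ⟨θ, subset_adjoin K _ (by simp)⟩)
    {ε : ℚ} (hε : 0 < ε) : ∃ b : adjoin K {θ, η}, σ b ≠ b ∧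
      hahnVal p (σ b - b : adjoin K {θ, η}) ≤ 0 ∧ ((-ε : ℚ) : WithTop ℚ) ≤ hahnVal p b := by
  have := hK.perfect
  have hθm : θ ∈ adjoin K {θ} := subset_adjoin K {θ} rfl
  have hαm : α ∈ adjoin K {θ} := hθ ▸ sub_mem (pow_mem hθm p) hθm
  have hle : adjoin K {θ} ≤ adjoin K {θ, η} := adjoin.mono _ _ _ (by simp)
  have hfix : σ.toAlgHom.comp (inclusion hle) = inclusion hle := by
    refine adjoin_algHom_ext K fun s hs => ?_
    obtain rfl : s = θ := hs
    exact hσθ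
  have hfix' : ∀ b (hb : b ∈ adjoin K {θ}), σ ⟨b, hle hb⟩ = ⟨b, hle hb⟩ :=
    fun b hb => congrArg (fun g : _ →ₐ[K] _ => g ⟨b, hb⟩) hfix
  set η' : adjoin K {θ, η} := ⟨η, subset_adjoin K _ (by simp)⟩ with hη'
  have hση : σ η' ≠ η' := by
    intro h0
    refine hσ (algEquiv_eq_one_of_generators σ fun s hs => ?_)
    obtain rfl | rfl := hs
    · exact hσθ
    · exact h0
  have hη1 : η' ^ p - η' = ⟨α, hle hαm⟩ ^ 2 := Subtype.ext hη
  -- Since `σ` fixes `α`, the elements `σ η` and `η` have the same Artin-Schreier polynomial, so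
  -- they differ by a constant.
  obtain ⟨ζ, hζ, -⟩ := exists_eq_add_of_pow_sub_self (p := p) hK.constHom (a := 0) (x := σ η')
    (y := η') (by
      rw [← map_pow, ← map_sub, hη1, map_pow, hfix' α hαm, map_zero, map_zero, add_zero])
  have hint : IsIntegral K θ := by
    refine isIntegral_of_pow_sub_self (p := p) (hθ ▸ isIntegral_of_pow_sub_self (p := p) ?_)
    rw [hα]
    exact isIntegral_algebraMap (x := (⟨_, hK.single_mem 1⟩ : K))
  have : Algebra.IsAlgebraic K (adjoin K {θ}) := isAlgebraic_adjoin (by rintro s rfl; exact hint)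
  refine exists_move_of_approx hK hle σ hfix' hση hζ
    (exists_approx_of_pow_sub_self (exists_mem_pow_eq _)
      (fun δ _ => ⟨α ^ 2, pow_mem hαm 2, ?_⟩) hε)
  change _ ≤ hahnVal p (η ^ p - η - α ^ 2)
  rw [hη, sub_self, AddValuation.map_zero]
  exact le_top

/-- The third Artin-Schreier step. -/
theorem onlyMaxIdeal_adjoin_theta_eta (hK : IsBaseField K) (hp2 : 2 < p) {α θ η : Hahn p}
    (hα : α ^ p - α = HahnSeries.single (-1) 1) (hθ : θ ^ p - θ = α) (hη : η ^ p - η = α ^ 2) :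
    OnlyMaxIdeal K (adjoin K {θ, η}) (p ^ 3) := by
  have := hK.perfect
  have hαa : α ^ p - α = algebraMap K (Hahn p) ⟨_, hK.single_mem 1⟩ := hα
  have := isGalois_adjoin_theta_eta hK.constHom hαa hθ hη
  have hdeg := finrank_adjoin_theta_eta hK.constHom hp2 hαa hθ hη
    (hK.notMem_range_of_pow_sub_self one_ne_zero hα) fun c hc =>
      hK.notMem_range_of_pow_sub_self (neg_pow_ne_zero hc) (gamma_pow_sub_self hα hθ hc)
  refine onlyMaxIdeal_of_exists hK (adjoin K {θ, η}) three_ne_zero hdeg fun σ hσ ε hε => ?_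
  set θ' : adjoin K {θ, η} := ⟨θ, subset_adjoin K _ (by simp)⟩ with hθ'
  -- If `σ` moves `θ`, the shift is constant and `θ` works over `K`. Otherwise `σ` fixes `K(θ)` and
  -- `η` takes over; when `σ` moves `α`, the shift of `η` need not be constant.
  by_cases hσθ : σ θ' = θ'
  · exact exists_move_of_fixes_theta hK hα hθ hη hσ hσθ hε
  obtain ⟨i, -, hi⟩ := exists_conj_alpha (p := p) hK.constHom σ.toAlgHom (AlgHom.id K _)
    (α := θ' ^ p - θ') (a := ⟨_, hK.single_mem 1⟩) (Subtype.ext (by simpa [hθ', hθ] using hαa))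
  obtain ⟨ζ, -, hζ⟩ := exists_conj_theta (p := p) hK.constHom σ.toAlgHom (AlgHom.id K _) rfl hi
  refine exists_move_of_approx hK (F := ⊥) bot_le σ ?_ hσθ hζ (exists_approx_theta hK hα hθ hε)
  rintro _ ⟨y, rfl⟩
  exact σ.commutes y

end Extensions

end RamIdeals

theorem mainTheorem7 (p : ℕ) [Fact p.Prime] (K : Subfield (RamIdeals.Hahn p))
    (hK : RamIdeals.IsBaseField K) (α θ η : RamIdeals.Hahn p)
    (hα : α ^ p - α = HahnSeries.single (-1) 1) (hθ : θ ^ p - θ = α)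
    (hη : η ^ p - η = α ^ 2) (c : AlgebraicClosure (ZMod p)) (hc : c ^ p - c = 1)
    (γ : RamIdeals.Hahn p) (hγ : γ = θ - HahnSeries.C c * α) :
    RamIdeals.OnlyMaxIdeal K (IntermediateField.adjoin K {α}) p ∧
    RamIdeals.OnlyMaxIdeal K (IntermediateField.adjoin K {γ}) p ∧
    RamIdeals.OnlyMaxIdeal K (IntermediateField.adjoin K {θ}) (p ^ 2) ∧
    (2 < p → RamIdeals.OnlyMaxIdeal K (IntermediateField.adjoin K {θ, η}) (p ^ 3)) := by
  subst hγ
  exact ⟨RamIdeals.onlyMaxIdeal_adjoin_alpha hK one_ne_zero hα,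
    RamIdeals.onlyMaxIdeal_adjoin_alpha hK (RamIdeals.neg_pow_ne_zero hc)
      (RamIdeals.gamma_pow_sub_self hα hθ hc),
    RamIdeals.onlyMaxIdeal_adjoin_theta hK hα hθ,
    fun hp2 => RamIdeals.onlyMaxIdeal_adjoin_theta_eta hK hp2 hα hθ hη⟩
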